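/- For integers $m,k\ge 0$ define polynomials in $\mathbb{Q}[x]$ by $$P_m(x)=\sum_{i=0}^{m}\sum_{j=0}^{m}\binom{x+j}{j}\binom{x-1}{j}\binom{j}{i}\binom{m}{i}\binom{i}{m-j}\frac{3}{(2i-1)(2j+1)(2m-2i-1)},\qquad B_k(x)=\binom{x+k}{2k}+\binom{-x+k}{2k},$$ where $\binom{f}{j}=f(f-1)\cdots(f-j+1)/j!$ for a polynomial $f$ and an integer $j\ge0$. Then for every $m\ge 0$: 1. $P_m(x)$ is an integer for every integer $x$. 2. $P_m$ can be written in exactly one way as a finite rational linear combination $P_m=\sum_{k\ge0}d(m,k)\,B_k$ with $d(m,k)\in\mathbb{Q}$, and $d(m,k)=0$ for $k>m$. All the coefficients $d(m,k)$ are integers if $m\ge1$, and $d(0,0)=\tfrac32$. -/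

import Mathlib

/-- The binomial coefficient `f (f - 1) ⋯ (f - j + 1) / j!` of a polynomial `f` over `ℚ`, again a
polynomial over `ℚ`. -/
noncomputable def polyChoose (f : Polynomial ℚ) (j : ℕ) : Polynomial ℚ :=
  Polynomial.C ((j.factorial : ℚ)⁻¹) * (descPochhammer ℚ j).comp f

/-- The coefficient
`C(j,i) * C(m,i) * C(i,m-j) * 3 / ((2i-1)(2j+1)(2m-2i-1))`, used for `j ≤ m` only.
The three factors of the denominator are odd integers, so they are nonzero. -/
def termCoeff (m i j : ℕ) : ℚ :=
  (j.choose i : ℚ) * (m.choose i : ℚ) * (i.choose (m - j) : ℚ) *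
    (3 / ((2 * (i : ℚ) - 1) * (2 * (j : ℚ) + 1) * (2 * (m : ℚ) - 2 * (i : ℚ) - 1)))

/-- The polynomial `P_m(x)`, the sum over `0 ≤ i, j ≤ m` of
`C(x+j,j) * C(x-1,j) * C(j,i) * C(m,i) * C(i,m-j) * 3 / ((2i-1)(2j+1)(2m-2i-1))`. -/
noncomputable def polyP (m : ℕ) : Polynomial ℚ :=
  ∑ i ∈ Finset.range (m + 1), ∑ j ∈ Finset.range (m + 1),
    polyChoose (Polynomial.X + (j : Polynomial ℚ)) j * polyChoose (Polynomial.X - 1) j *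
      Polynomial.C (termCoeff m i j)

/-- The polynomial `B_k(x) = C(x+k,2k) + C(-x+k,2k)`. -/
noncomputable def polyB (k : ℕ) : Polynomial ℚ :=
  polyChoose (Polynomial.X + (k : Polynomial ℚ)) (2 * k) +
    polyChoose (-Polynomial.X + (k : Polynomial ℚ)) (2 * k)

/-! Put A_j = C(x+j,j) C(x-1,j) = ∏_{l=1}^{j} (x² - l²) / j!². Then A_0 = B_0/2 and A_{j+1} + A_j =
(C(2j+2,j+1)/2) B_{j+1}. If the coefficient of A_j in P_m is t_j + t_{j+1} with t_{m+1} = 0,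
summation by parts gives P_m = ∑ (C(2k,k)/2) t_k B_k (`polyP_eq_sum`). So t_k is an alternating tail
sum.

For m ≥ 2 it has a closed form (`sum_termCoeff_eq`), found by partial fractions, the symmetry i ↦
m-i, a telescoping sum and Vandermonde. Its summands, multiplied by C(2k,k)/2, are integer
combinations of factorial quotients, whose integrality follows from Landau's criterion and Catalan
numbers (`exists_int_altPartialSum`). The cases m = 0, 1 are explicit.

Uniqueness holds because B_k vanishes at 0, …, k-1 but not at k. Integer values follow from those of
B_k, except for m = 0, where P_0 = 3. -/

/-! ### Landau's criterion and divisibility of factorial products -/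

open Nat in
/-- Landau's criterion: a quotient of products of factorials is an integer as soon as the
corresponding inequality between floors holds. -/
theorem prod_factorial_dvd_of_sum_div_le (num den : List ℕ)
    (h : ∀ Q : ℕ, 1 < Q → (den.map (· / Q)).sum ≤ (num.map (· / Q)).sum) :
    (den.map factorial).prod ∣ (num.map factorial).prod := by
  have ne (l : List ℕ) : (l.map factorial).prod ≠ 0 := by
    simp [List.prod_eq_zero_iff, factorial_ne_zero]
  have key (p b : ℕ) (hp : p.Prime) (l : List ℕ) (hb : ∀ n ∈ l, log p n < b) :
      (l.map factorial).prod.factorization p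
        = ∑ i ∈ Finset.Ico 1 b, (l.map (· / p ^ i)).sum := by
    induction l with
    | nil => simp
    | cons n l ih =>
      simp only [List.map_cons, List.prod_cons, List.sum_cons, Finset.sum_add_distrib]
      rw [Nat.factorization_mul (factorial_ne_zero n) (ne l), Finsupp.add_apply,
        ih fun x hx => hb x (List.mem_cons_of_mem _ hx),
        Nat.factorization_factorial hp (hb n List.mem_cons_self)]
  rw [← Nat.factorization_prime_le_iff_dvd (ne _) (ne _)]
  intro p hp
  have bd (l : List ℕ) : ∀ n ∈ l, log p n < l.sum + 1 := fun n hn =>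
    lt_succ_of_le ((log_le_self p n).trans (List.single_le_sum (by simp) _ hn))
  rw [key p (den.sum + num.sum + 1) hp den fun n hn => (bd den n hn).trans_le (by omega),
    key p (den.sum + num.sum + 1) hp num fun n hn => (bd num n hn).trans_le (by omega)]
  exact Finset.sum_le_sum fun i hi =>
    h _ (Nat.one_lt_pow (Nat.one_le_iff_ne_zero.1 (Finset.mem_Ico.1 hi).1) hp.one_lt)

theorem Nat.div_eq_add_div_of_eq {Q e r s : ℕ} (hQ : 0 < Q) (h : e = r + Q * s) :
    e / Q = s + r / Q := by
  rw [h, Nat.add_mul_div_left _ _ hQ, add_comm]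

theorem Nat.exists_div_eq {Q : ℕ} (r : ℕ) (hQ : 0 < Q) :
    ∃ x, r / Q = x ∧ Q * x ≤ r ∧ r < Q * x + Q :=
  ⟨r / Q, rfl, Nat.mul_div_le r Q, Nat.lt_mul_div_succ r hQ⟩

/-- This is the Landau inequality for `factorial_dvd_double` on remainders mod Q. The linear forms
on both sides have the same total, so the quotients of a, b, c cancel. -/
theorem floor_ineq_aux {Q a b c : ℕ} (hQ : 0 < Q) (ha : a < Q) (hb : b < Q) (hc : c < Q) :
    (a + b + c + 1) / Q + (2 * (b + c) + 1) / Q + (2 * (a + c) + 1) / Q ≤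
      (2 * (a + b + c + 1)) / Q + (a + b + 2 * c + 2) / Q + (b + c) / Q + (a + c) / Q := by
  obtain ⟨n, hn, hn1, hn2⟩ := Nat.exists_div_eq (a + b + c + 1) hQ
  obtain ⟨p, hp, hp1, hp2⟩ := Nat.exists_div_eq (2 * (b + c) + 1) hQ
  obtain ⟨q, hq, hq1, hq2⟩ := Nat.exists_div_eq (2 * (a + c) + 1) hQ
  have hn3 : n ≤ 2 := by
    by_contra! h
    nlinarith
  have hp3 : p ≤ 3 := by
    by_contra! h
    nlinarith
  have hq3 : q ≤ 3 := by
    by_contra! h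
    nlinarith
  -- Once the left-hand floors are fixed numerals, these conditional lower bounds make every case
  -- linear in Q and the remainders.
  have lo (v r : ℕ) (h : v * Q ≤ r) : v ≤ r / Q := (Nat.le_div_iff_mul_le hQ).2 h
  rw [hn, hp, hq]
  have a1 := lo 1 (b + c)
  have a2 := lo 1 (a + c)
  have n1 := lo (2 * n) (2 * (a + b + c + 1)) (by nlinarith)
  have n2 := lo (2 * n + 1) (2 * (a + b + c + 1))
  have m1 := lo 1 (a + b + 2 * c + 2)
  have m2 := lo 2 (a + b + 2 * c + 2)
  have m3 := lo 3 (a + b + 2 * c + 2)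
  generalize (b + c) / Q = z1 at *
  generalize (a + c) / Q = z2 at *
  generalize (2 * (a + b + c + 1)) / Q = z3 at *
  generalize (a + b + 2 * c + 2) / Q = z4 at *
  clear lo hn hp hq
  interval_cases n <;> interval_cases p <;> interval_cases q <;> omega

open Nat in
theorem factorial_mul_catalan (p : ℕ) : p ! * (p + 1)! * catalan p = (2 * p)! := by
  have h1 := succ_mul_catalan_eq_centralBinom p
  have h2 := Nat.choose_mul_factorial_mul_factorial (show p ≤ 2 * p by omega)
  rw [← Nat.centralBinom_eq_two_mul_choose, ← h1, show 2 * p - p = p by omega] at h2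
  rw [← h2, Nat.factorial_succ]
  ring

open Nat in
theorem factorial_dvd_double (a b c : ℕ) :
    (a + b + c + 1)! * a ! * b ! * c ! * (2 * (b + c) + 1)! * (2 * (a + c) + 1)! ∣
      (2 * (a + b + c + 1))! * (a + b + 2 * c + 2)! * (b + c)! * (a + c)! := by
  have := prod_factorial_dvd_of_sum_div_le
    [2 * (a + b + c + 1), a + b + 2 * c + 2, b + c, a + c]
    [a + b + c + 1, a, b, c, 2 * (b + c) + 1, 2 * (a + c) + 1] ?_
  · simpa [mul_assoc] using this
  intro Q hQ1
  have hQ : 0 < Q := by omega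
  simp only [List.map_cons, List.map_nil, List.sum_cons, List.sum_nil]
  have ea := Nat.mod_add_div a Q
  have eb := Nat.mod_add_div b Q
  have ec := Nat.mod_add_div c Q
  have key := floor_ineq_aux hQ (Nat.mod_lt a hQ) (Nat.mod_lt b hQ) (Nat.mod_lt c hQ)
  generalize a % Q = ra at *
  generalize b % Q = rb at *
  generalize c % Q = rc at *
  have e1 := Nat.div_eq_add_div_of_eq (e := a + b + c + 1) (r := ra + rb + rc + 1)
    (s := a / Q + b / Q + c / Q) hQ (by linarith)
  have e2 := Nat.div_eq_add_div_of_eq (e := 2 * (b + c) + 1) (r := 2 * (rb + rc) + 1)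
    (s := 2 * (b / Q) + 2 * (c / Q)) hQ (by linarith)
  have e3 := Nat.div_eq_add_div_of_eq (e := 2 * (a + c) + 1) (r := 2 * (ra + rc) + 1)
    (s := 2 * (a / Q) + 2 * (c / Q)) hQ (by linarith)
  have e4 := Nat.div_eq_add_div_of_eq (e := 2 * (a + b + c + 1)) (r := 2 * (ra + rb + rc + 1))
    (s := 2 * (a / Q) + 2 * (b / Q) + 2 * (c / Q)) hQ (by linarith)
  have e5 := Nat.div_eq_add_div_of_eq (e := a + b + 2 * c + 2) (r := ra + rb + 2 * rc + 2)
    (s := a / Q + b / Q + 2 * (c / Q)) hQ (by linarith)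
  have e6 := Nat.div_eq_add_div_of_eq (e := b + c) (r := rb + rc)
    (s := b / Q + c / Q) hQ (by linarith)
  have e7 := Nat.div_eq_add_div_of_eq (e := a + c) (r := ra + rc)
    (s := a / Q + c / Q) hQ (by linarith)
  omega

open Nat in
theorem factorial_dvd_single (a p : ℕ) :
    (a + p + 1)! * a ! * (2 * p + 1)! ∣ (2 * (a + p + 1))! * p ! := by
  have := prod_factorial_dvd_of_sum_div_le
    [2 * (a + p + 1), p] [a + p + 1, a, 2 * p + 1] ?_
  · simpa [mul_assoc] using this
  intro Q hQ1
  have hQ : 0 < Q := by omega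
  simp only [List.map_cons, List.map_nil, List.sum_cons, List.sum_nil]
  have ea := Nat.mod_add_div a Q
  have ep := Nat.mod_add_div p Q
  have la := Nat.mod_lt a hQ
  have lp := Nat.mod_lt p hQ
  generalize a % Q = ra at *
  generalize p % Q = rp at *
  have e1 := Nat.div_eq_add_div_of_eq (e := a + p + 1) (r := ra + rp + 1)
    (s := a / Q + p / Q) hQ (by linarith)
  have e2 := Nat.div_eq_add_div_of_eq (e := 2 * p + 1) (r := 2 * rp + 1)
    (s := 2 * (p / Q)) hQ (by linarith)
  have e3 := Nat.div_eq_add_div_of_eq (e := 2 * (a + p + 1)) (r := 2 * (ra + rp + 1))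
    (s := 2 * (a / Q) + 2 * (p / Q)) hQ (by linarith)
  obtain ⟨x, hx, hx1, hx2⟩ := Nat.exists_div_eq (ra + rp + 1) hQ
  obtain ⟨y, hy, hy1, hy2⟩ := Nat.exists_div_eq (2 * rp + 1) hQ
  have hx3 : x ≤ 1 := by
    by_contra! h
    nlinarith
  have hy3 : y ≤ 1 := by
    by_contra! h
    nlinarith
  have lo (v r : ℕ) (h : v * Q ≤ r) : v ≤ r / Q := (Nat.le_div_iff_mul_le hQ).2 h
  have n1 := lo (2 * x) (2 * (ra + rp + 1)) (by nlinarith)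
  have n2 := lo (2 * x + 1) (2 * (ra + rp + 1))
  rw [hx] at e1
  rw [hy] at e2
  clear lo ea ep
  generalize (2 * (ra + rp + 1)) / Q = z at *
  interval_cases x <;> interval_cases y <;> omega

set_option maxHeartbeats 1000000 in
open Nat in
theorem factorial_dvd_boundary (e c s : ℕ) (hs : s ≤ 1) :
    (e + c + 1)! * (e + c + 2)! * (e + c + 2)! * c ! * e ! * (e + 2 * c + 2 + s)! ∣
      (2 * (e + c + 2))! * (2 * (e + c + 1))! * (e + 2 * c + s)! := by
  have := prod_factorial_dvd_of_sum_div_le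
    [2 * (e + c + 2), 2 * (e + c + 1), e + 2 * c + s]
    [e + c + 1, e + c + 2, e + c + 2, c, e, e + 2 * c + 2 + s] ?_
  · simpa [mul_assoc] using this
  intro Q hQ1
  have hQ : 0 < Q := by omega
  simp only [List.map_cons, List.map_nil, List.sum_cons, List.sum_nil]
  have ee := Nat.mod_add_div e Q
  have ec := Nat.mod_add_div c Q
  have le := Nat.mod_lt e hQ
  have lc := Nat.mod_lt c hQ
  generalize e % Q = re at *
  generalize c % Q = rc at *
  have e1 := Nat.div_eq_add_div_of_eq (e := e + c + 1) (r := re + rc + 1)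
    (s := e / Q + c / Q) hQ (by linarith)
  have e2 := Nat.div_eq_add_div_of_eq (e := e + c + 2) (r := re + rc + 2)
    (s := e / Q + c / Q) hQ (by linarith)
  have e3 := Nat.div_eq_add_div_of_eq (e := e + 2 * c + 2 + s) (r := re + 2 * rc + 2 + s)
    (s := e / Q + 2 * (c / Q)) hQ (by linarith)
  have e4 := Nat.div_eq_add_div_of_eq (e := 2 * (e + c + 2)) (r := 2 * (re + rc + 2))
    (s := 2 * (e / Q) + 2 * (c / Q)) hQ (by linarith)
  have e5 := Nat.div_eq_add_div_of_eq (e := 2 * (e + c + 1)) (r := 2 * (re + rc + 1))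
    (s := 2 * (e / Q) + 2 * (c / Q)) hQ (by linarith)
  have e6 := Nat.div_eq_add_div_of_eq (e := e + 2 * c + s) (r := re + 2 * rc + s)
    (s := e / Q + 2 * (c / Q)) hQ (by linarith)
  obtain ⟨x, hx, hx1, hx2⟩ := Nat.exists_div_eq (re + rc + 1) hQ
  obtain ⟨y, hy, hy1, hy2⟩ := Nat.exists_div_eq (re + rc + 2) hQ
  obtain ⟨z, hz, hz1, hz2⟩ := Nat.exists_div_eq (re + 2 * rc + 2 + s) hQ
  have hx3 : x ≤ 1 := by
    by_contra! h
    nlinarith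
  have hy3 : y ≤ 2 := by
    by_contra! h
    nlinarith
  have hz3 : z ≤ 3 := by
    by_contra! h
    nlinarith
  have lo (v r : ℕ) (h : v * Q ≤ r) : v ≤ r / Q := (Nat.le_div_iff_mul_le hQ).2 h
  have n1 := lo (2 * x) (2 * (re + rc + 1)) (by nlinarith)
  have n2 := lo (2 * x + 1) (2 * (re + rc + 1))
  have n3 := lo (2 * y) (2 * (re + rc + 2)) (by nlinarith)
  have n4 := lo (2 * y + 1) (2 * (re + rc + 2))
  have n5 := lo 1 (re + 2 * rc + s)
  have n6 := lo 2 (re + 2 * rc + s)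
  rw [hx] at e1
  rw [hy] at e2
  rw [hz] at e3
  clear lo ee ec
  generalize (2 * (re + rc + 1)) / Q = z1 at *
  generalize (2 * (re + rc + 2)) / Q = z2 at *
  generalize (re + 2 * rc + s) / Q = z3 at *
  suffices x + 2 * y + z ≤ z1 + z2 + z3 by omega
  clear e1 e2 e3 e4 e5 e6 hx hy hz
  interval_cases s <;> interval_cases x <;> interval_cases y <;> interval_cases z <;> omega

/-! ### Expansion in the polynomials B_k -/

section
open Polynomial

theorem descPochhammer_comp_X_add_mul (j : ℕ) :
    (descPochhammer ℚ j).comp (X + (j : ℚ[X])) * (descPochhammer ℚ j).comp (X - 1) =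
      ∏ l ∈ Finset.range j, (X ^ 2 - ((l : ℚ[X]) + 1) ^ 2) := by
  induction j with
  | zero => simp
  | succ j ih =>
    rw [Finset.prod_range_succ, ← ih]
    nth_rw 1 [descPochhammer_succ_left]
    rw [descPochhammer_succ_right, mul_comp, mul_comp, comp_assoc]
    have : (X - 1 : ℚ[X]).comp (X + ((j + 1 : ℕ) : ℚ[X])) = X + (j : ℚ[X]) := by
      simp
      ring
    rw [this]
    simp
    ring

/-- The sign ε = ±1 treats both halves of B_k together; the terms odd in x cancel on adding them. -/
theorem descPochhammer_even_comp (ε : ℚ) (hε : ε ^ 2 = 1) (k : ℕ) :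
    (descPochhammer ℚ (2 * (k + 1))).comp (C ε * X + ((k + 1 : ℕ) : ℚ[X])) =
      (X ^ 2 + C ε * X * ((k + 1 : ℕ) : ℚ[X])) *
        ∏ l ∈ Finset.range k, (X ^ 2 - ((l : ℚ[X]) + 1) ^ 2) := by
  have hC : (C ε : ℚ[X]) ^ 2 = 1 := by rw [← C_pow, hε, C_1]
  induction k with
  | zero =>
    simp [descPochhammer_succ_left]
    linear_combination X ^ 2 * hC
  | succ k ih =>
    rw [show 2 * (k + 1 + 1) = 2 * (k + 1) + 1 + 1 by ring, descPochhammer_succ_left, mul_comp,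
      comp_assoc, descPochhammer_succ_right, mul_comp]
    have : (X - 1 : ℚ[X]).comp (C ε * X + ((k + 1 + 1 : ℕ) : ℚ[X]))
        = C ε * X + ((k + 1 : ℕ) : ℚ[X]) := by
      simp
      ring
    rw [this, ih, Finset.prod_range_succ]
    simp
    generalize ∏ l ∈ Finset.range k, (X ^ 2 - ((l : ℚ[X]) + 1) ^ 2) = R
    linear_combination (X ^ 2 * (X ^ 2 + C ε * X * (k + 1)) * R + X ^ 2 * (k + 1) * R) * hC

theorem polyB_zero : polyB 0 = 2 := by
  simp [polyB, polyChoose]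
  norm_num

theorem polyB_succ (k : ℕ) :
    polyB (k + 1) = C (2 / ((2 * (k + 1)).factorial : ℚ)) *
      (X ^ 2 * ∏ l ∈ Finset.range k, (X ^ 2 - ((l : ℚ[X]) + 1) ^ 2)) := by
  have h1 := descPochhammer_even_comp 1 (by norm_num) k
  have h2 := descPochhammer_even_comp (-1) (by norm_num) k
  simp only [C_neg, C_1, one_mul, neg_mul] at h1 h2
  rw [polyB, polyChoose, polyChoose, h1, h2, div_eq_mul_inv, C_mul,
    show (C (2 : ℚ) : ℚ[X]) = 2 from rfl]
  ring

theorem polyChoose_mul_polyChoose (j : ℕ) :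
    polyChoose (X + (j : ℚ[X])) j * polyChoose (X - 1) j =
      C (((j.factorial : ℚ) ^ 2)⁻¹) *
        ∏ l ∈ Finset.range j, (X ^ 2 - ((l : ℚ[X]) + 1) ^ 2) := by
  rw [← descPochhammer_comp_X_add_mul, polyChoose, polyChoose, sq, mul_inv, C_mul]
  ring

/-- Over the common denominator (j+1)!², the last factors add up to (x² - (j+1)²) + (j+1)² = x²,
which is the extra factor of B_{j+1}. -/
theorem polyChoose_mul_add_succ (j : ℕ) :
    polyChoose (X + ((j + 1 : ℕ) : ℚ[X])) (j + 1) * polyChoose (X - 1) (j + 1) +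
      polyChoose (X + (j : ℚ[X])) j * polyChoose (X - 1) j =
      (((2 * (j + 1)).choose (j + 1) : ℚ) / 2) • polyB (j + 1) := by
  rw [polyChoose_mul_polyChoose, polyChoose_mul_polyChoose, polyB_succ, Finset.prod_range_succ,
    smul_eq_C_mul, ← mul_assoc (C (_ / 2)), ← C_mul]
  have hf : (((2 * (j + 1)).choose (j + 1) : ℚ) / 2) * (2 / ((2 * (j + 1)).factorial : ℚ))
      = (((j + 1).factorial : ℚ) ^ 2)⁻¹ := by
    rw [Nat.cast_choose ℚ (by omega), show 2 * (j + 1) - (j + 1) = j + 1 by omega]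
    have := Nat.factorial_ne_zero (2 * (j + 1))
    have := Nat.factorial_ne_zero (j + 1)
    field_simp
  have hg : ((j.factorial : ℚ) ^ 2)⁻¹ = (((j + 1).factorial : ℚ) ^ 2)⁻¹ * ((j : ℚ) + 1) ^ 2 := by
    rw [Nat.factorial_succ]
    have := Nat.factorial_ne_zero j
    push_cast
    field_simp
  rw [hf, hg, C_mul]
  simp
  ring

theorem sum_smul_polyChoose_mul (m : ℕ) (t : ℕ → ℚ) :
    ∑ j ∈ Finset.range (m + 1), (t j + t (j + 1)) •
        (polyChoose (X + (j : ℚ[X])) j * polyChoose (X - 1) j) =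
      ∑ k ∈ Finset.range (m + 1), (((2 * k).choose k : ℚ) / 2 * t k) • polyB k +
        t (m + 1) • (polyChoose (X + (m : ℚ[X])) m * polyChoose (X - 1) m) := by
  induction m with
  | zero =>
    simp [polyChoose, polyB_zero, smul_eq_C_mul]
    rw [show (2 : ℚ[X]) = C 2 from rfl, mul_assoc, mul_comm, mul_assoc, ← C_mul]
    norm_num
  | succ m ih =>
    rw [Finset.sum_range_succ, ih, Finset.sum_range_succ _ (m + 1), mul_comm _ (t (m + 1)),
      mul_smul, ← polyChoose_mul_add_succ]
    module

theorem polyP_eq_sum (m : ℕ) (t : ℕ → ℚ) (h0 : t (m + 1) = 0)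
    (h : ∀ k ≤ m, ∑ i ∈ Finset.range (m + 1), termCoeff m i k = t k + t (k + 1)) :
    polyP m = ∑ k ∈ Finset.range (m + 1), (((2 * k).choose k : ℚ) / 2 * t k) • polyB k := by
  have := sum_smul_polyChoose_mul m t
  rw [h0, zero_smul, add_zero] at this
  rw [← this, polyP, Finset.sum_comm]
  refine Finset.sum_congr rfl fun j hj => ?_
  rw [← Finset.mul_sum, ← h j (by simpa [Nat.lt_succ_iff] using hj), smul_eq_C_mul, mul_comm,
    map_sum]

theorem polyB_eval_eq_zero {k n : ℕ} (h : n < k) : (polyB k).eval (n : ℚ) = 0 := by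
  obtain ⟨k, rfl⟩ : ∃ l, k = l + 1 := ⟨k - 1, by omega⟩
  rw [polyB_succ]
  rcases n with _ | n
  · simp
  · simp only [eval_mul, eval_prod, eval_C, eval_pow, eval_X]
    rw [Finset.prod_eq_zero (i := n) (by simp; omega) (by simp)]
    simp

theorem polyB_eval_self_ne_zero (k : ℕ) : (polyB k).eval (k : ℚ) ≠ 0 := by
  rcases k with _ | k
  · simp [polyB_zero]
  · rw [polyB_succ]
    simp only [eval_mul, eval_prod, eval_C, eval_pow, eval_X]
    refine mul_ne_zero (by positivity) (mul_ne_zero (by positivity) ?_)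
    refine Finset.prod_ne_zero_iff.2 fun l hl => ?_
    have hl' : (l : ℚ) < k := by exact_mod_cast Finset.mem_range.1 hl
    have h0 : (0 : ℚ) ≤ l := by positivity
    simp
    nlinarith

/-- Evaluation at 0, 1, 2, … is triangular with nonzero diagonal. -/
theorem linearIndependent_polyB : LinearIndependent ℚ polyB := by
  rw [linearIndependent_iff]
  intro c hc
  ext n
  induction n using Nat.strong_induction_on with
  | _ n ih =>
    have h := congrArg (eval (n : ℚ)) hc
    rw [Finsupp.linearCombination_apply, Finsupp.sum, eval_finsetSum, eval_zero] at h
    by_contra hn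
    have hn' : c n ≠ 0 := hn
    rw [Finset.sum_eq_single_of_mem n (by simpa using hn')] at h
    · simp only [eval_smul, smul_eq_mul, mul_eq_zero] at h
      exact h.elim hn' (polyB_eval_self_ne_zero n)
    · intro b _ hb
      rcases lt_or_gt_of_ne hb with hb | hb
      · simp [ih b hb]
      · simp [polyB_eval_eq_zero hb]

end

/-! ### Recurrences and sums of the binomial weight -/

/-- The integer weight `C(k,i) * C(m,i) * C(i,m-k)`, vanishing for `k > m`. -/
def binomWeight (m k i : ℕ) : ℚ :=
  if k ≤ m then (k.choose i : ℚ) * (m.choose i : ℚ) * (i.choose (m - k) : ℚ) else 0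

theorem cast_choose_succ_mul (n k : ℕ) :
    (n.choose (k + 1) : ℚ) * (k + 1) = n.choose k * (n - k) := by
  rcases le_or_gt k n with h | h
  · have := Nat.choose_succ_right_eq n k
    rw [← Nat.cast_sub h]
    exact_mod_cast this
  · simp [Nat.choose_eq_zero_of_lt h, Nat.choose_eq_zero_of_lt (h.trans (Nat.lt_succ_self k))]

theorem cast_succ_choose_mul (n k : ℕ) :
    ((n + 1).choose k : ℚ) * (n + 1 - k) = n.choose k * (n + 1) := by
  rcases le_or_gt k (n + 1) with h | h
  · have := Nat.choose_mul_succ_eq n k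
    have e : ((n : ℚ) + 1 - k) = ((n + 1 - k : ℕ) : ℚ) := by
      rw [Nat.cast_sub h]
      push_cast
      rfl
    rw [e]
    exact_mod_cast this.symm
  · simp [Nat.choose_eq_zero_of_lt h, Nat.choose_eq_zero_of_lt (show n < k by omega)]

/-- At k = m the cutoff in `binomWeight` matches the factor m - k = 0. -/
theorem binomWeight_succ_left (m k i : ℕ) (hk : k ≤ m) :
    binomWeight m (k + 1) i * (k + 1 - i) * (k + 1 - (m - i)) =
      binomWeight m k i * (k + 1) * (m - k) := by
  rcases hk.eq_or_lt with rfl | hk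
  · simp [binomWeight]
  · obtain ⟨c, rfl⟩ : ∃ c, m = k + 1 + c := ⟨m - (k + 1), by omega⟩
    simp only [binomWeight, if_pos (show k + 1 ≤ k + 1 + c by omega),
      if_pos (show k ≤ k + 1 + c by omega), show k + 1 + c - (k + 1) = c by omega,
      show k + 1 + c - k = c + 1 by omega]
    have h1 := cast_succ_choose_mul k i
    have h2 := cast_choose_succ_mul i c
    push_cast
    linear_combination ((k + 1 + c).choose i * i.choose c * ((i : ℚ) - c)) * h1 -
      ((k + 1 + c).choose i * k.choose i * ((k : ℚ) + 1)) * h2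

theorem binomWeight_succ_right (m k i : ℕ) (hk : k ≤ m) :
    binomWeight m k (i + 1) * (i + 1) * (i + 1) * (i + 1 - (m - k)) =
      binomWeight m k i * (k - i) * (m - i) * (i + 1) := by
  simp only [binomWeight, if_pos hk]
  have h1 := cast_choose_succ_mul k i
  have h2 := cast_choose_succ_mul m i
  have h3 := cast_succ_choose_mul i (m - k)
  rw [Nat.cast_sub hk] at h3
  linear_combination
    (m.choose (i + 1) * ((i : ℚ) + 1) * ((i + 1).choose (m - k)) * (i + 1 - (m - k))) * h1 +
    (k.choose i * ((k : ℚ) - i) * ((i + 1).choose (m - k)) * (i + 1 - (m - k))) * h2 +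
    (k.choose i * ((k : ℚ) - i) * m.choose i * (m - i)) * h3

theorem binomWeight_reflect (m k i : ℕ) (hi : i ≤ m) :
    binomWeight m k (m - i) = binomWeight m k i := by
  unfold binomWeight
  split_ifs with hk
  · rw [Nat.choose_symm hi]
    have key : k.choose (m - i) * (m - i).choose (m - k) = k.choose i * i.choose (m - k) := by
      rcases le_or_gt i k with h1 | h1
      · rcases le_or_gt (m - i) k with h2 | h2
        · rw [Nat.choose_mul (by omega : m - k ≤ m - i), Nat.choose_mul (by omega : m - k ≤ i),
            ← Nat.choose_symm (n := k - (m - k)) (by omega)]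
          congr 2
          omega
        · simp [Nat.choose_eq_zero_of_lt h2, Nat.choose_eq_zero_of_lt (show i < m - k by omega)]
      · simp [Nat.choose_eq_zero_of_lt h1, Nat.choose_eq_zero_of_lt (show m - i < m - k by omega)]
    have key' : (k.choose (m - i) * (m - i).choose (m - k) : ℚ) = k.choose i * i.choose (m - k) := by
      exact_mod_cast key
    linear_combination (m.choose i : ℚ) * key'
  · rfl

/-- Since C(k,i) C(i,m-k) = C(k,m-k) C(2k-m,k-i), this is Vandermonde's convolution for C(2k,k). -/
theorem sum_binomWeight (m k : ℕ) (hk : k ≤ m) :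
    ∑ i ∈ Finset.range (m + 1), binomWeight m k i =
      (k.choose (m - k) : ℚ) * (2 * k).choose k := by
  simp only [binomWeight, if_pos hk]
  norm_cast
  rcases le_or_gt (m - k) k with hc | hc
  · rw [show 2 * k = m + (k - (m - k)) by omega, Nat.add_choose_eq,
      Finset.Nat.sum_antidiagonal_eq_sum_range_succ_mk, Finset.mul_sum]
    symm
    refine Finset.sum_subset_zero_on_sdiff (fun x hx => ?_) (fun x hx => ?_) (fun x hx => ?_)
    · simp only [Finset.mem_range] at hx ⊢
      omega
    · simp only [Finset.mem_sdiff, Finset.mem_range] at hx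
      simp [Nat.choose_eq_zero_of_lt (show k < x by omega)]
    · have hx' : x ≤ k := by simpa [Nat.lt_succ_iff] using hx
      rcases le_or_gt (m - k) x with h | h
      · rw [mul_right_comm, Nat.choose_mul h,
          ← Nat.choose_symm (n := k - (m - k)) (k := x - (m - k)) (by omega),
          show k - (m - k) - (x - (m - k)) = k - x by omega]
        ring
      · simp [Nat.choose_eq_zero_of_lt h,
          Nat.choose_eq_zero_of_lt (show k - (m - k) < k - x by omega)]
  · rw [Nat.choose_eq_zero_of_lt hc, zero_mul]
    refine Finset.sum_eq_zero fun i _ => ?_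
    rcases le_or_gt i k with h | h
    · simp [Nat.choose_eq_zero_of_lt (show i < m - k by omega)]
    · simp [Nat.choose_eq_zero_of_lt h]

theorem sum_binomWeight_telescope (m k : ℕ) (hk : k ≤ m) :
    ∑ i ∈ Finset.range (m + 1), binomWeight m k i *
      ((k : ℚ) - i - i * (k - (m - i)) / (m - i + 1)) = 0 := by
  -- A telescoping certificate: W vanishes at 0 through the factor i, and at m+1 because C(m,m+1) =
  -- 0.
  let W : ℕ → ℚ := fun i => binomWeight m k i * (i * (k - (m - i)) / (m - i + 1))
  have h : ∀ i ∈ Finset.range (m + 1), binomWeight m k i *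
      ((k : ℚ) - i - i * (k - (m - i)) / (m - i + 1)) = W (i + 1) - W i := by
    intro i hi
    rw [mul_sub]
    congr 1
    simp only [W]
    have hi' : i ≤ m := by simpa [Nat.lt_succ_iff] using hi
    rcases hi'.eq_or_lt with rfl | hlt
    · rcases hk.eq_or_lt with rfl | hk'
      · simp
      · simp [binomWeight, Nat.choose_eq_zero_of_lt hk']
    · have h1 := binomWeight_succ_right m k i hk
      have h2 : (m : ℚ) - i ≠ 0 := sub_ne_zero.2 (by exact_mod_cast hlt.ne')
      have h3 : (i : ℚ) + 1 ≠ 0 := by positivity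
      push_cast
      rw [show (m : ℚ) - (i + 1) + 1 = m - i by ring]
      field_simp
      apply mul_right_cancel₀ h3
      linear_combination -h1
  rw [Finset.sum_congr rfl h, Finset.sum_range_sub]
  simp [W, binomWeight]

/-- The boundary term `C(2k,k) * C(k,m-k) * (2k-m) * (2k-m-1)`, vanishing for `k > m`. -/
def boundaryTerm (m k : ℕ) : ℚ :=
  if k ≤ m then ((2 * k).choose k : ℚ) * k.choose (m - k) * (2 * k - m) * (2 * k - m - 1) else 0

theorem boundaryTerm_succ (m k : ℕ) (hk : k ≤ m) :
    boundaryTerm m (k + 1) =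
      (k.choose (m - k) : ℚ) * (2 * k).choose k * (2 * (2 * k + 1) * (m - k)) := by
  rcases hk.eq_or_lt with rfl | hk
  · simp [boundaryTerm]
  · obtain ⟨c, rfl⟩ : ∃ c, m = k + 1 + c := ⟨m - (k + 1), by omega⟩
    simp only [boundaryTerm, if_pos (show k + 1 ≤ k + 1 + c by omega),
      show k + 1 + c - (k + 1) = c by omega, show k + 1 + c - k = c + 1 by omega]
    have h1 := cast_succ_choose_mul k c
    have h2 := cast_choose_succ_mul k c
    have h3 : ((k : ℚ) + 1) * (2 * (k + 1)).choose (k + 1) = 2 * (2 * k + 1) * (2 * k).choose k := by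
      exact_mod_cast Nat.succ_mul_centralBinom_succ k
    push_cast
    linear_combination ((2 * (k + 1)).choose (k + 1) * ((k : ℚ) - c)) * h1 +
      (k.choose c * ((k : ℚ) - c)) * h3 - (2 * (2 * k + 1) * (2 * k).choose k : ℚ) * h2

/-- Rests on (2k-m)(2k-m-1) + 2(2k-1)(m-k) = m(m-1), which is free of k. -/
theorem boundaryTerm_add_succ (m k : ℕ) (hk : k ≤ m) :
    boundaryTerm m k / (2 * k - 1) + boundaryTerm m (k + 1) / (2 * k + 1) =
      m * (m - 1) * (∑ i ∈ Finset.range (m + 1), binomWeight m k i) / (2 * k - 1) := by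
  have h1 : (2 * (k : ℚ) - 1) ≠ 0 := by
    rw [sub_ne_zero]
    exact_mod_cast (show 2 * k ≠ 1 by omega)
  have h2 : (2 * (k : ℚ) + 1) ≠ 0 := by positivity
  rw [boundaryTerm_succ m k hk, sum_binomWeight m k hk, boundaryTerm, if_pos hk]
  field_simp
  ring

/-! ### Closed form of the alternating tail sums -/

theorem two_mul_sub_one_ne_zero (n : ℕ) : (2 * (n : ℚ) - 1) ≠ 0 := by
  rw [sub_ne_zero]
  exact_mod_cast (show 2 * n ≠ 1 by omega)

/-- The summand of the closed form for the alternating partial sums of the coefficients. -/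
def partialSummand (m k i : ℕ) : ℚ :=
  binomWeight m k i * (k - i) * (k - (m - i)) * (4 / (2 * k - 1)) *
    (1 / ((2 * i - 1) * (2 * (m - i) - 1)) - 1 / ((2 * i - 1) * (m - i + 1)))

/-- The alternating sum over `j ≥ k` of the coefficients of `P_m`, for `m ≥ 2`. -/
def altPartialSum (m k : ℕ) : ℚ :=
  ∑ i ∈ Finset.range (m + 1), partialSummand m k i +
    boundaryTerm m k * (m - 3) / ((2 * k - 1) * (m * (m - 1) * (m + 1)))

/-- After summation over i, the last term on the left telescopes to zero and the multiple of the
bare weight is supplied by the boundary terms. The right side is the coefficient after partial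
fractions and reflection. -/
theorem partialSummand_add_succ (m k i : ℕ) (hk : k ≤ m) (hi : i ≤ m) :
    partialSummand m k i + partialSummand m (k + 1) i +
      binomWeight m k i * ((m - 3) / ((m + 1) * (2 * k - 1))) +
      4 / ((m + 1) * ((2 * k - 1) * (2 * k + 1))) * (binomWeight m k i *
        ((k : ℚ) - i - i * (k - (m - i)) / (m - i + 1))) =
    (2 * m + 1) / (2 * k + 1) * (binomWeight m k i / ((2 * i - 1) * (2 * (m - i) - 1))) -
      2 / (2 * k + 1) * (binomWeight m k i / (2 * i - 1)) := by
  have h1 := two_mul_sub_one_ne_zero k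
  have h2 : (2 * (k : ℚ) + 1) ≠ 0 := by positivity
  have h3 := two_mul_sub_one_ne_zero i
  have h4 := two_mul_sub_one_ne_zero (m - i)
  have h5 : ((m : ℚ) + 1) ≠ 0 := by positivity
  rw [Nat.cast_sub hi] at h4
  have h6 : (m : ℚ) - i + 1 ≠ 0 := by
    rw [← Nat.cast_sub hi]
    positivity
  have hr := binomWeight_succ_left m k i hk
  have e : partialSummand m (k + 1) i = binomWeight m k i * (k + 1) * (m - k) * (4 / (2 * k + 1)) *
    (1 / ((2 * i - 1) * (2 * (m - i) - 1)) - 1 / ((2 * i - 1) * (m - i + 1))) := by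
    rw [partialSummand, ← hr]
    push_cast
    ring
  rw [e, partialSummand]
  generalize binomWeight m k i = h
  clear e hr
  -- Taking the odd numbers 2k-1, 2i-1, 2(m-i)-1 as variables simplifies the denominators.
  obtain ⟨K, hK⟩ : ∃ K : ℚ, (k : ℚ) = (K + 1) / 2 := ⟨2 * k - 1, by ring⟩
  obtain ⟨A, hA⟩ : ∃ A : ℚ, (i : ℚ) = (A + 1) / 2 := ⟨2 * i - 1, by ring⟩
  obtain ⟨B, hB⟩ : ∃ B : ℚ, (m : ℚ) = (A + 1) / 2 + (B + 1) / 2 := 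
    ⟨2 * m - 2 * i - 1, by rw [hA]; ring⟩
  simp only [hK, hA, hB, add_sub_cancel_left, mul_div_cancel₀ _ (two_ne_zero' ℚ),
    add_sub_cancel_right] at h1 h2 h3 h4 h5 h6 ⊢
  rw [show (B + 1) / 2 + 1 = (B + 3) / 2 by ring] at h6 ⊢
  rw [show (A + 1) / 2 + (B + 1) / 2 + 1 = (A + B + 4) / 2 by ring] at h5 ⊢
  rw [show K + 1 + 1 = K + 2 by ring] at h2 ⊢
  have h5' : A + B + 4 ≠ 0 := fun h0 => h5 (by rw [h0, zero_div])
  have h6' : B + 3 ≠ 0 := fun h0 => h6 (by rw [h0, zero_div])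
  field_simp
  ring

theorem sum_termCoeff_eq (m k : ℕ) (hk : k ≤ m) (hm : 2 ≤ m) :
    ∑ i ∈ Finset.range (m + 1), termCoeff m i k = altPartialSum m k + altPartialSum m (k + 1) := by
  have h2 : (2 * (k : ℚ) + 1) ≠ 0 := by positivity
  have hrefl : ∑ i ∈ Finset.range (m + 1), binomWeight m k i / (2 * (m - i) - 1) =
      ∑ i ∈ Finset.range (m + 1), binomWeight m k i / (2 * i - 1) := by
    rw [← Finset.sum_range_reflect]
    refine Finset.sum_congr rfl fun i hi => ?_
    have hi' : i ≤ m := by simpa [Nat.lt_succ_iff] using hi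
    rw [show m + 1 - 1 - i = m - i by omega, binomWeight_reflect m k i hi', Nat.cast_sub hi']
    ring
  -- Partial fractions from 3 = (2m+1) - (2i-1) - (2(m-i)-1); the two single-pole sums agree by
  -- `hrefl`.
  have lhs : ∑ i ∈ Finset.range (m + 1), termCoeff m i k =
      (2 * m + 1) / (2 * k + 1) *
        ∑ i ∈ Finset.range (m + 1), binomWeight m k i / ((2 * i - 1) * (2 * (m - i) - 1)) -
      2 / (2 * k + 1) * ∑ i ∈ Finset.range (m + 1), binomWeight m k i / (2 * i - 1) := by
    rw [show ∀ s : ℚ, 2 / (2 * (k : ℚ) + 1) * s = 1 / (2 * k + 1) * s + 1 / (2 * k + 1) * s by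
      intro s; ring]
    nth_rw 2 [← hrefl]
    simp only [Finset.mul_sum]
    rw [← Finset.sum_add_distrib, ← Finset.sum_sub_distrib]
    refine Finset.sum_congr rfl fun i hi => ?_
    have hi' : i ≤ m := by simpa [Nat.lt_succ_iff] using hi
    have h3 := two_mul_sub_one_ne_zero i
    have h4 := two_mul_sub_one_ne_zero (m - i)
    rw [Nat.cast_sub hi'] at h4
    rw [termCoeff, binomWeight, if_pos hk]
    generalize (k.choose i : ℚ) * (m.choose i : ℚ) * (i.choose (m - k) : ℚ) = h
    obtain ⟨j, hj⟩ : ∃ j : ℚ, (m : ℚ) = i + j := ⟨m - i, by ring⟩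
    rw [show 2 * (m : ℚ) - 2 * i - 1 = 2 * j - 1 by rw [hj]; ring]
    simp only [hj, add_sub_cancel_left] at h4 ⊢
    field_simp
    ring
  have tele := sum_binomWeight_telescope m k hk
  have bd := boundaryTerm_add_succ m k hk
  have main := Finset.sum_congr rfl fun i (hi : i ∈ Finset.range (m + 1)) =>
    partialSummand_add_succ m k i hk (by simpa [Nat.lt_succ_iff] using hi)
  rw [Finset.sum_sub_distrib, Finset.sum_add_distrib, Finset.sum_add_distrib,
    Finset.sum_add_distrib, ← Finset.mul_sum, ← Finset.mul_sum, ← Finset.mul_sum,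
    ← Finset.sum_mul, tele, mul_zero, add_zero] at main
  rw [lhs, ← main, altPartialSum, altPartialSum]
  have m1 : (m : ℚ) ≠ 0 := by positivity
  have m2 : (m : ℚ) - 1 ≠ 0 := by
    rw [sub_ne_zero]
    exact_mod_cast (show m ≠ 1 by omega)
  have m3 : (m : ℚ) + 1 ≠ 0 := by positivity
  have h1 := two_mul_sub_one_ne_zero k
  rw [show 2 * (((k + 1 : ℕ) : ℚ)) - 1 = 2 * k + 1 by push_cast; ring]
  have e : boundaryTerm m k * (m - 3) / ((2 * k - 1) * (m * (m - 1) * (m + 1))) +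
      boundaryTerm m (k + 1) * (m - 3) / ((2 * k + 1) * (m * (m - 1) * (m + 1))) =
      (∑ i ∈ Finset.range (m + 1), binomWeight m k i) * ((m - 3) / ((m + 1) * (2 * k - 1))) := by
    calc _ = (boundaryTerm m k / (2 * k - 1) + boundaryTerm m (k + 1) / (2 * k + 1)) *
          ((m - 3) / (m * (m - 1) * (m + 1))) := by
          field_simp
      _ = _ := by
          rw [bd]
          field_simp
  linear_combination -e

theorem altPartialSum_succ_self (m : ℕ) : altPartialSum m (m + 1) = 0 := by
  simp [altPartialSum, partialSummand, boundaryTerm, binomWeight]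

/-! ### Integrality of the coefficients -/

-- The right side is the n-th Catalan number, so the denominator 2k-1 at k = n+1 is absorbed.
open Nat in
theorem half_choose_div_eq (n : ℕ) :
    ((2 * (n + 1)).choose (n + 1) : ℚ) / 2 / (2 * ((n + 1 : ℕ) : ℚ) - 1) =
      ((2 * n)! : ℚ) / ((n + 1)! * n !) := by
  have h1 : ((n : ℚ) + 1) * (2 * (n + 1)).choose (n + 1) = 2 * (2 * n + 1) * (2 * n).choose n := by
    exact_mod_cast Nat.succ_mul_centralBinom_succ n
  have h2 : ((2 * n).choose n : ℚ) = (2 * n)! / (n ! * n !) := by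
    rw [two_mul, Nat.cast_add_choose]
  have h3 := two_mul_sub_one_ne_zero (n + 1)
  have h4 : (n ! : ℚ) ≠ 0 := by exact_mod_cast n.factorial_ne_zero
  have h5 : (n : ℚ) + 1 ≠ 0 := by positivity
  rw [h2] at h1
  rw [Nat.factorial_succ, div_div, div_eq_div_iff (mul_ne_zero two_ne_zero h3) (by positivity)]
  field_simp at h1
  push_cast
  linear_combination h1

-- Here a = k-i-1, b = k-(m-i)-1, c = m-k; the factors a+1 and b+1 are those occurring in
-- `partialSummand`.
open Nat in
theorem binomWeight_mul_eq (a b c : ℕ) :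
    binomWeight (a + b + 2 * c + 2) (a + b + c + 2) (b + c + 1) * (a + 1) * (b + 1) =
      ((a + b + c + 2)! * (a + b + 2 * c + 2)! : ℚ) /
        (a ! * b ! * c ! * (b + c + 1)! * (a + c + 1)!) := by
  rw [binomWeight, if_pos (by omega),
    show a + b + 2 * c + 2 - (a + b + c + 2) = c by omega,
    show a + b + c + 2 = (b + c + 1) + (a + 1) by ring, Nat.cast_add_choose,
    show a + b + 2 * c + 2 = (b + c + 1) + (a + c + 1) by ring, Nat.cast_add_choose,
    show (b + c + 1).choose c = (c + (b + 1)).choose c by congr 1; ring, Nat.cast_add_choose,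
    show c + (b + 1) = b + c + 1 by ring, Nat.factorial_succ a, Nat.factorial_succ b]
  push_cast
  field_simp

-- With p = b+c, (2p+1)! = (2p+1) p! (p+1)! `catalan p`, and likewise for a+c. Thus the Landau
-- quotient times two Catalan numbers is the required integer.
open Nat in
theorem exists_int_double (a b c : ℕ) : ∃ z : ℤ,
    ((2 * (a + b + c + 1))! : ℚ) / ((a + b + c + 2)! * (a + b + c + 1)!) *
      (((a + b + c + 2)! * (a + b + 2 * c + 2)! : ℚ) /
        (a ! * b ! * c ! * (b + c + 1)! * (a + c + 1)!)) /
      ((2 * (b + c) + 1) * (2 * (a + c) + 1)) = z := by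
  obtain ⟨N, hN⟩ := factorial_dvd_double a b c
  have hp := factorial_mul_catalan (b + c)
  have hq := factorial_mul_catalan (a + c)
  refine ⟨catalan (b + c) * catalan (a + c) * N, ?_⟩
  rw [Nat.factorial_succ (2 * (b + c)), Nat.factorial_succ (2 * (a + c)), ← hp, ← hq] at hN
  have hN' := congrArg (Nat.cast : ℕ → ℚ) hN
  push_cast at hN' ⊢
  have h1 : ((b + c)! : ℚ) ≠ 0 := by positivity
  have h2 : ((a + c)! : ℚ) ≠ 0 := by positivity
  have e : ((2 * (a + b + c + 1))! : ℚ) * (a + b + 2 * c + 2)! =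
      (a + b + c + 1)! * a ! * b ! * c ! * ((2 * (b + c) + 1) * (b + c + 1)! * catalan (b + c)) *
        ((2 * (a + c) + 1) * (a + c + 1)! * catalan (a + c)) * N := by
    apply mul_right_cancel₀ (mul_ne_zero h1 h2)
    linear_combination hN'
  field_simp
  linear_combination e

-- Only one odd denominator remains, so a smaller Landau quotient and one Catalan number suffice;
-- two binomial coefficients account for (a+b+2c+2)!.
open Nat in
theorem exists_int_single (a b c : ℕ) : ∃ z : ℤ,
    ((2 * (a + b + c + 1))! : ℚ) / ((a + b + c + 2)! * (a + b + c + 1)!) *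
      (((a + b + c + 2)! * (a + b + 2 * c + 2)! : ℚ) /
        (a ! * b ! * c ! * (b + c + 1)! * (a + c + 1)!)) /
      ((2 * (b + c) + 1) * (a + c + 2)) = z := by
  obtain ⟨N, hN⟩ := factorial_dvd_single a (b + c)
  have hM1 := Nat.add_choose_mul_factorial_mul_factorial b c
  have hM2 := Nat.add_choose_mul_factorial_mul_factorial (b + c) (a + c + 2)
  have hp := factorial_mul_catalan (b + c)
  refine ⟨catalan (b + c) * N * (b + c).choose c * (b + c + (a + c + 2)).choose (a + c + 2), ?_⟩
  rw [Nat.factorial_succ (2 * (b + c)), ← hp, ← add_assoc] at hN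
  rw [← hM1, show b + c + (a + c + 2) = a + b + 2 * c + 2 by ring,
    Nat.factorial_succ (a + c + 1)] at hM2
  have hN' := congrArg (Nat.cast : ℕ → ℚ) hN
  have hM' := congrArg (Nat.cast : ℕ → ℚ) hM2
  push_cast at hN' hM' ⊢
  have h1 : ((b + c)! : ℚ) ≠ 0 := by positivity
  have e : ((2 * (a + b + c + 1))! : ℚ) =
      (a + b + c + 1)! * a ! * ((2 * (b + c) + 1) * (b + c + 1)! * catalan (b + c)) * N := by
    apply mul_right_cancel₀ h1
    linear_combination hN'
  rw [show b + c + (a + c + 2) = a + b + 2 * c + 2 by ring, ← hM', e]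
  field_simp
  ring

-- With m = e+2c+2, the shifts s = 0, 1 give the denominators m(m-1) and (m+1)m.
open Nat in
theorem exists_int_boundary (e c s : ℕ) (hs : s ≤ 1) : ∃ z : ℤ,
    ((2 * (e + c + 1))! : ℚ) / ((e + c + 2)! * (e + c + 1)!) *
      (2 * (e + c + 2)).choose (e + c + 2) * ((e + c + 2)! / (c ! * e !)) /
      ((e + 2 * c + 2 + s) * (e + 2 * c + 1 + s)) = z := by
  obtain ⟨N, hN⟩ := factorial_dvd_boundary e c s hs
  refine ⟨N, ?_⟩
  rw [show e + 2 * c + 2 + s = e + 2 * c + s + 1 + 1 by ring,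
    Nat.factorial_succ (e + 2 * c + s + 1), Nat.factorial_succ (e + 2 * c + s)] at hN
  have hN' := congrArg (Nat.cast : ℕ → ℚ) hN
  push_cast at hN' ⊢
  have h1 : ((e + 2 * c + s)! : ℚ) ≠ 0 := by positivity
  have e' : ((2 * (e + c + 2))! : ℚ) * (2 * (e + c + 1))! =
      (e + c + 1)! * (e + c + 2)! * (e + c + 2)! * c ! * e ! * ((e + 2 * c + s + 1 + 1) *
        (e + 2 * c + s + 1)) * N := by
    apply mul_right_cancel₀ h1
    linear_combination hN'
  rw [two_mul (e + c + 2), Nat.cast_add_choose, ← two_mul]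
  field_simp
  linear_combination e'

theorem exists_int_partialSummand (m k i : ℕ) (hi : i ≤ m) :
    ∃ z : ℤ, ((2 * k).choose k : ℚ) / 2 * partialSummand m k i = z := by
  -- A nonzero term forces i < k, m-i < k and k ≤ m, so that a, b, c are natural numbers.
  by_cases h0 : binomWeight m k i * (k - i) * (k - (m - i)) = 0
  · exact ⟨0, by simp [partialSummand, h0]⟩
  have hkm : k ≤ m := by
    by_contra h
    simp [binomWeight, h] at h0
  have hik : i < k := by
    by_contra! h
    rcases h.eq_or_lt with rfl | h
    · simp at h0
    · simp [binomWeight, Nat.choose_eq_zero_of_lt h] at h0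
  have hik' : m - i < k := by
    by_contra! h
    rcases h.eq_or_lt with h | h
    · rw [← Nat.cast_sub hi, ← h] at h0
      simp at h0
    · simp [binomWeight, Nat.choose_eq_zero_of_lt (show i < m - k by omega)] at h0
  obtain ⟨a, b, c, rfl, rfl, rfl⟩ : ∃ a b c, m = a + b + 2 * c + 2 ∧ k = a + b + c + 2 ∧
      i = b + c + 1 := ⟨k - i - 1, k - (m - i) - 1, m - k, by omega, by omega, by omega⟩
  obtain ⟨z1, h1⟩ := exists_int_double a b c
  obtain ⟨z2, h2⟩ := exists_int_single a b c
  refine ⟨4 * z1 - 4 * z2, ?_⟩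
  have hC := half_choose_div_eq (a + b + c + 1)
  push_cast
  rw [← h1, ← h2, ← binomWeight_mul_eq, ← hC, partialSummand]
  push_cast
  rw [show ((a : ℚ) + b + c + 2 - (b + c + 1)) = a + 1 by ring,
    show ((a : ℚ) + b + 2 * c + 2 - (b + c + 1)) = a + c + 1 by ring,
    show ((a : ℚ) + b + c + 2 - (a + c + 1)) = b + 1 by ring,
    show 2 * ((b : ℚ) + c + 1) - 1 = 2 * (b + c) + 1 by ring,
    show 2 * ((a : ℚ) + c + 1) - 1 = 2 * (a + c) + 1 by ring]
  ring

theorem exists_int_boundaryTerm (m k : ℕ) (hm : 2 ≤ m) :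
    ∃ z : ℤ, ((2 * k).choose k : ℚ) / 2 *
      (boundaryTerm m k * (m - 3) / ((2 * k - 1) * (m * (m - 1) * (m + 1)))) = z := by
  by_cases h0 : boundaryTerm m k = 0
  · exact ⟨0, by simp [h0]⟩
  have hkm : k ≤ m := by
    by_contra h
    simp [boundaryTerm, h] at h0
  have hk : m ≤ 2 * k := by
    by_contra! h
    simp [boundaryTerm, Nat.choose_eq_zero_of_lt (show k < m - k by omega)] at h0
  have hk1 : m ≠ 2 * k := by
    rintro rfl
    simp [boundaryTerm] at h0
  have hk2 : m + 1 ≠ 2 * k := by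
    intro h
    have : (2 * k : ℚ) = m + 1 := by exact_mod_cast h.symm
    simp [boundaryTerm, this] at h0
  obtain ⟨e, c, rfl, rfl⟩ : ∃ e c, m = e + 2 * c + 2 ∧ k = e + c + 2 :=
    ⟨2 * k - m - 2, m - k, by omega, by omega⟩
  obtain ⟨z1, h1⟩ := exists_int_boundary e c 0 (by norm_num)
  obtain ⟨z2, h2⟩ := exists_int_boundary e c 1 (by norm_num)
  -- Partial fractions: (m-3)/((m-1)m(m+1)) = -1/(m(m-1)) + 2/(m(m+1)).
  refine ⟨-z1 + 2 * z2, ?_⟩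
  have hC := half_choose_div_eq (e + c + 1)
  have hch : ((e + c + 2).choose c : ℚ) * (e + 2) * (e + 1) =
      (e + c + 2).factorial / (c.factorial * e.factorial) := by
    rw [show e + c + 2 = c + (e + 2) by ring, Nat.cast_add_choose, Nat.factorial_succ (e + 1),
      Nat.factorial_succ e]
    push_cast
    field_simp
    ring
  push_cast
  rw [← h1, ← h2, ← hch, ← hC, boundaryTerm, if_pos (by omega),
    show e + 2 * c + 2 - (e + c + 2) = c by omega]
  have d := two_mul_sub_one_ne_zero (e + c + 2)
  push_cast at d ⊢
  rw [show 2 * ((e : ℚ) + c + 2) - (e + 2 * c + 2) = e + 2 by ring,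
    show (e : ℚ) + 2 - 1 = e + 1 by ring,
    show (e : ℚ) + 2 * c + 2 - 1 = e + 2 * c + 1 by ring,
    show (e : ℚ) + c + 1 + 1 = e + c + 2 by ring]
  field_simp
  ring

theorem exists_int_altPartialSum (m k : ℕ) (hm : 2 ≤ m) :
    ∃ z : ℤ, ((2 * k).choose k : ℚ) / 2 * altPartialSum m k = z := by
  obtain ⟨z, hz⟩ := exists_int_boundaryTerm m k hm
  choose! f hf using fun i (hi : i ≤ m) => exists_int_partialSummand m k i hi
  refine ⟨∑ i ∈ Finset.range (m + 1), f i + z, ?_⟩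
  rw [altPartialSum, mul_add, hz, Finset.mul_sum]
  push_cast
  congr 1
  exact Finset.sum_congr rfl fun i hi => hf i (by simpa [Nat.lt_succ_iff] using hi)

/-! ### Integer values, small cases and assembly -/

open Polynomial in
theorem exists_int_polyChoose_eval (f : ℚ[X]) (j : ℕ) (x y : ℤ) (h : f.eval (x : ℚ) = y) :
    ∃ z : ℤ, (polyChoose f j).eval (x : ℚ) = z := by
  refine ⟨Ring.choose y j, ?_⟩
  have h1 := Ring.descPochhammer_eq_factorial_smul_choose y j
  rw [polyChoose, eval_mul, eval_C, eval_comp, h, ← descPochhammer_eval_cast, eval_eq_smeval, h1,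
    nsmul_eq_mul]
  push_cast
  field_simp

open Polynomial in
theorem exists_int_polyB_eval (k : ℕ) (x : ℤ) : ∃ z : ℤ, (polyB k).eval (x : ℚ) = z := by
  obtain ⟨u, hu⟩ := exists_int_polyChoose_eval (X + (k : ℚ[X])) (2 * k) x (x + k) (by simp)
  obtain ⟨v, hv⟩ := exists_int_polyChoose_eval (-X + (k : ℚ[X])) (2 * k) x (-x + k) (by simp)
  exact ⟨u + v, by rw [polyB, eval_add, hu, hv]; push_cast; rfl⟩

/-- The closed form divides by m(m-1), so m = 0 and m = 1 need explicit values of t. -/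
theorem polyP_zero : polyP 0 = (3 / 2 : ℚ) • polyB 0 := by
  rw [polyP_eq_sum 0 (fun k => if k = 0 then 3 else 0) (by simp)]
  · norm_num
  · intro k hk
    obtain rfl : k = 0 := by omega
    norm_num [termCoeff]

theorem polyP_one : polyP 1 = ∑ k ∈ Finset.range 2,
    (((2 * k).choose k : ℚ) / 2 * if k = 0 then 2 else if k = 1 then -2 else 0) • polyB k := by
  refine polyP_eq_sum 1 (fun k => if k = 0 then 2 else if k = 1 then -2 else 0) (by simp) ?_
  intro k hk
  interval_cases k <;> norm_num [termCoeff, Finset.sum_range_succ]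

theorem exists_polyP_eq_sum (m : ℕ) : ∃ a : ℕ → ℚ,
    polyP m = ∑ k ∈ Finset.range (m + 1), a k • polyB k ∧
      (1 ≤ m → ∀ k, ∃ n : ℤ, a k = n) ∧ (m = 0 → a 0 = 3 / 2) := by
  obtain rfl | rfl | hm : m = 0 ∨ m = 1 ∨ 2 ≤ m := by omega
  · exact ⟨fun _ => 3 / 2, by simp [polyP_zero], by simp, by simp⟩
  · refine ⟨_, polyP_one, fun _ k => ?_, by simp⟩
    rcases k with _ | _ | k
    · exact ⟨1, by norm_num⟩
    · exact ⟨-2, by norm_num⟩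
    · exact ⟨0, by simp⟩
  · exact ⟨_, polyP_eq_sum m (altPartialSum m) (altPartialSum_succ_self m)
      fun k hk => sum_termCoeff_eq m k hk hm,
      fun _ k => exists_int_altPartialSum m k hm, by omega⟩

theorem exists_finsupp_polyP (m : ℕ) : ∃ d : ℕ →₀ ℚ,
    polyP m = d.sum (fun k a => a • polyB k) ∧ (∀ k, m < k → d k = 0) ∧
      (1 ≤ m → ∀ k, ∃ n : ℤ, d k = n) ∧ (m = 0 → d 0 = 3 / 2) := by
  obtain ⟨a, h1, h2, h3⟩ := exists_polyP_eq_sum m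
  let d : ℕ →₀ ℚ := Finsupp.onFinset (Finset.range (m + 1)) (fun k => if k ≤ m then a k else 0)
    fun k hk => by
      by_contra h
      simp only [Finset.mem_range, Nat.lt_succ_iff] at h
      exact hk (if_neg h)
  have hd (k : ℕ) : d k = if k ≤ m then a k else 0 := rfl
  refine ⟨d, ?_, fun k hk => by rw [hd, if_neg (by omega)], fun hm k => ?_, fun hm => ?_⟩
  · rw [h1, Finsupp.onFinset_sum _ (by simp)]
    refine Finset.sum_congr rfl fun k hk => ?_
    rw [if_pos (by simpa [Nat.lt_succ_iff] using hk)]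
  · rw [hd]
    split_ifs
    · exact h2 hm k
    · exact ⟨0, by simp⟩
  · rw [hd, if_pos (Nat.zero_le _), h3 hm]

theorem exists_int_polyP_eval (m : ℕ) (x : ℤ) :
    ∃ n : ℤ, (polyP m).eval (x : ℚ) = (n : ℚ) := by
  rcases Nat.eq_zero_or_pos m with rfl | hm
  · exact ⟨3, by rw [polyP_zero, polyB_zero, Polynomial.eval_smul]; norm_num⟩
  · obtain ⟨a, h1, h2, -⟩ := exists_polyP_eq_sum m
    choose f hf using h2 hm
    choose g hg using fun k => exists_int_polyB_eval k x
    refine ⟨∑ k ∈ Finset.range (m + 1), f k * g k, ?_⟩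
    rw [h1, Polynomial.eval_finsetSum]
    push_cast
    exact Finset.sum_congr rfl fun k _ => by rw [Polynomial.eval_smul, smul_eq_mul, hf, hg]

theorem mainTheorem1 :
    (∀ (m : ℕ) (x : ℤ), ∃ n : ℤ, (polyP m).eval (x : ℚ) = (n : ℚ)) ∧
    ∃ d : ℕ → ℕ →₀ ℚ,
      (∀ m : ℕ, polyP m = (d m).sum (fun k a => a • polyB k)) ∧
      (∀ (m : ℕ) (c : ℕ →₀ ℚ), polyP m = c.sum (fun k a => a • polyB k) → c = d m) ∧
      (∀ m k : ℕ, m < k → d m k = 0) ∧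
      (∀ m : ℕ, 1 ≤ m → ∀ k : ℕ, ∃ n : ℤ, d m k = (n : ℚ)) ∧
      d 0 0 = 3 / 2 := by
  choose d h1 h2 h3 h4 using exists_finsupp_polyP
  refine ⟨exists_int_polyP_eval, d, h1, fun m c hc => ?_, h2, h3, h4 0 rfl⟩
  apply linearIndependent_polyB
  rw [Finsupp.linearCombination_apply, Finsupp.linearCombination_apply, ← hc, h1 m]
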